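/- For a real function $f$, let $\|f\|_{[a,b]}$ denote the maximum of $|f|$ on $[a,b]$. There are universal constants $C,K,c>0$ such that the following hold. (1) For all real $\beta\ge 1$ and $\varepsilon\in(0,1)$ there is a real polynomial $p$ of degree at most $C\,\beta\log(\beta/\varepsilon)$ such that $\|p\|_{[-1,1]}\le K$ and $\|p(x)-e^{\beta x}\|_{[-1,0]}\le\varepsilon$. (2) (Near-tightness of the degree.) For all real $\beta\ge 1$ and $\delta\in(0,1]$, every real polynomial $q$ with $|q(x)-e^{\beta x}|\le 0.1$ for $x\in[-1,0]$ and $|q(x)|\le 1$ for $x\in[0,\delta]$ has degree at least $c\,\beta\sqrt{\delta}$. -/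

import Mathlib

open Polynomial

/-- The maximum absolute value `‖f‖_{[a, b]}` of a real function `f` on `[a, b]`
(for continuous `f` and `a ≤ b` the supremum is attained, see below). -/
noncomputable def intervalNorm (f : ℝ → ℝ) (a b : ℝ) : ℝ :=
  sSup ((fun x => |f x|) '' Set.Icc a b)

/-- For a continuous function the supremum in `intervalNorm` is a maximum. -/
theorem intervalNorm_isGreatest {f : ℝ → ℝ} {a b : ℝ} (hab : a ≤ b)
    (hf : ContinuousOn f (Set.Icc a b)) :
    IsGreatest ((fun x => |f x|) '' Set.Icc a b) (intervalNorm f a b) :=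
  (isCompact_Icc.image_of_continuousOn hf.abs).isGreatest_sSup
    ((Set.nonempty_Icc.mpr hab).image _)

/-- For a continuous function, a bound on the norm is a pointwise bound. -/
theorem intervalNorm_le_iff {f : ℝ → ℝ} {a b M : ℝ} (hab : a ≤ b)
    (hf : ContinuousOn f (Set.Icc a b)) :
    intervalNorm f a b ≤ M ↔ ∀ x ∈ Set.Icc a b, |f x| ≤ M := by
  rw [isLUB_le_iff (intervalNorm_isGreatest hab hf).isLUB, mem_upperBounds,
    Set.forall_mem_image]

/-! Lower bound: between `-1/β` and `0` the polynomial `q` climbs by at least `0.4`, so its slope is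
at least `0.4 β` somewhere there, while `q` stays bounded on `[-1, δ]`. Bernstein's inequality,
rescaled to `[-1, δ]`, allows slope at most of order `deg q / √δ` at such a point.

Upper bound: convolve `exp (β y)`, cut off at `y = 1/β`, with a polynomial kernel `Q` concentrated
on `|u| ≤ 1/β`. Since `exp (β (x - u)) = exp (β x) exp (-β u)`, the central window reproduces `exp
(β x)` exactly once divided by `J = ∫ exp (-β u) Q u`. The rest of the integral is `O(1)`, against
`J` exponentially large in `k/β`. The cutoff keeps the weight at most `e`, hence the result is
bounded on all of `[-1, 1]`. The kernel is a Chebyshev polynomial `T_k` composed with a quadratic.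
-/

/-! ### Bernstein's inequality and the degree lower bound -/

open Complex in
/-- A real polynomial bounded by `M` on `[-1, 1]` grows at most like `M exp (n |Im w|)`
along the complex cosine. -/
theorem norm_eval_cos_le (p : ℝ[X]) {M : ℝ} (h : ∀ x ∈ Set.Icc (-1 : ℝ) 1, |p.eval x| ≤ M)
    (w : ℂ) : ‖(p.map (algebraMap ℝ ℂ)).eval (cos w)‖ ≤
      M * Real.exp (p.natDegree * |w.im|) := by
  wlog hw : 0 ≤ w.im generalizing w
  · have := this (-w) (by simp; linarith)
    simpa using this
  set n := p.natDegree with hn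
  -- With `z = exp (i u)`, `cos u = (z² + 1) / (2 z)`; the factor `z ^ n` clears denominators, so
  -- the maximum principle on the unit disc applies.
  let Q : ℂ → ℂ := fun z =>
    ∑ k ∈ Finset.range (n + 1), (p.coeff k : ℂ) * (z ^ (n - k) * ((z ^ 2 + 1) / 2) ^ k)
  have hQ : ∀ u : ℂ, Q (exp (u * I)) =
      exp (u * I) ^ n * (p.map (algebraMap ℝ ℂ)).eval (cos u) := by
    intro u
    have h1 : (exp (u * I) ^ 2 + 1) / 2 = exp (u * I) * cos u := by
      rw [cos, mul_div_assoc', mul_add, ← exp_add, ← exp_add, sq, ← exp_add]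
      simp
    rw [eval_eq_sum_range, natDegree_map, Finset.mul_sum]
    refine Finset.sum_congr rfl fun k hk => ?_
    have hk' : k ≤ n := Nat.lt_succ_iff.mp (Finset.mem_range.mp hk)
    rw [h1, mul_pow, coeff_map, ← mul_assoc (_ ^ (n - k)), ← pow_add, Nat.sub_add_cancel hk']
    simp only [coe_algebraMap]
    ring
  have hdiff : Differentiable ℂ Q := by
    intro z
    simp only [Q]
    fun_prop
  have hfr : ∀ z ∈ frontier (Metric.ball (0 : ℂ) 1), ‖Q z‖ ≤ M := by
    intro z hz
    rw [frontier_ball _ one_ne_zero, mem_sphere_zero_iff_norm] at hz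
    have hz' : z = exp ((z.arg : ℂ) * I) := by
      have := norm_mul_exp_arg_mul_I z
      rw [hz] at this
      simpa using this.symm
    rw [hz', hQ, ← ofReal_cos, norm_mul, norm_pow, norm_exp_ofReal_mul_I, one_pow, one_mul]
    have h2 : (p.map (algebraMap ℝ ℂ)).eval ((Real.cos z.arg : ℝ) : ℂ) =
        ((p.eval (Real.cos z.arg) : ℝ) : ℂ) := by
      rw [eval_map_algebraMap]
      exact aeval_algebraMap_apply_eq_algebraMap_eval _ _
    rw [h2, norm_real]
    exact h _ ⟨Real.neg_one_le_cos _, Real.cos_le_one _⟩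
  have hnorm : ‖exp (w * I)‖ = Real.exp (-w.im) := by
    rw [norm_exp]
    simp
  have hmem : exp (w * I) ∈ closure (Metric.ball (0 : ℂ) 1) := by
    rw [closure_ball _ one_ne_zero, mem_closedBall_zero_iff, hnorm]
    exact Real.exp_le_one_iff.mpr (by linarith)
  have hle := norm_le_of_forall_mem_frontier_norm_le Metric.isBounded_ball hdiff.diffContOnCl
    hfr hmem
  rw [hQ, norm_mul, norm_pow, hnorm, ← Real.exp_nat_mul] at hle
  have hexp : Real.exp (n * -w.im) * Real.exp (n * |w.im|) = 1 := by
    rw [← Real.exp_add, abs_of_nonneg hw]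
    simp
  calc _ = Real.exp (n * -w.im) * ‖(p.map (algebraMap ℝ ℂ)).eval (cos w)‖ *
        Real.exp (n * |w.im|) := by
        rw [mul_right_comm, hexp, one_mul]
    _ ≤ _ := by gcongr

/-- Bernstein's inequality on `[-1, 1]`, up to the constant `e`. -/
theorem abs_eval_derivative_mul_sqrt_le (p : ℝ[X]) {M : ℝ}
    (h : ∀ x ∈ Set.Icc (-1 : ℝ) 1, |p.eval x| ≤ M) {x : ℝ} (hx : x ∈ Set.Icc (-1 : ℝ) 1) :
    |p.derivative.eval x| * √(1 - x ^ 2) ≤ Real.exp 1 * p.natDegree * M := by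
  have hM : 0 ≤ M := (abs_nonneg _).trans (h 0 (by norm_num))
  rcases Nat.eq_zero_or_pos p.natDegree with h0 | hpos
  · rw [eq_C_of_natDegree_eq_zero h0]
    simp
  have hn : (0 : ℝ) < p.natDegree := by exact_mod_cast hpos
  set P := p.map (algebraMap ℝ ℂ)
  set θ := Real.arccos x with hθ
  have hderiv : HasDerivAt (fun w : ℂ => P.eval (Complex.cos w))
      (P.derivative.eval (Complex.cos θ) * -Complex.sin θ) (θ : ℂ) :=
    (P.hasDerivAt _).comp _ (Complex.hasDerivAt_cos _)
  -- Cauchy's estimate at radius `1/n`: there the growth factor is at most `e`.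
  have hcauchy := Complex.norm_deriv_le_of_forall_mem_sphere_norm_le
    (c := (θ : ℂ)) (R := 1 / p.natDegree) (C := M * Real.exp 1)
    (f := fun w : ℂ => P.eval (Complex.cos w)) (by positivity)
    (Differentiable.diffContOnCl
      fun w => ((P.hasDerivAt _).comp _ (Complex.hasDerivAt_cos w)).differentiableAt)
    (fun w hw => by
      refine (norm_eval_cos_le p h w).trans ?_
      have him : |w.im| ≤ 1 / p.natDegree := by
        have h1 := Complex.abs_im_le_norm (w - θ)
        rw [mem_sphere_iff_norm.mp hw] at h1
        simpa using h1
      gcongr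
      calc (p.natDegree : ℝ) * |w.im| ≤ p.natDegree * (1 / p.natDegree) := by gcongr
        _ = 1 := by field_simp)
  rw [hderiv.deriv, ← Complex.ofReal_cos, ← Complex.ofReal_sin, norm_mul, norm_neg,
    Complex.norm_real, hθ, Real.cos_arccos hx.1 hx.2, Real.sin_arccos] at hcauchy
  have h2 : P.derivative.eval (x : ℂ) = ((p.derivative.eval x : ℝ) : ℂ) := by
    rw [derivative_map, eval_map_algebraMap]
    exact aeval_algebraMap_apply_eq_algebraMap_eval _ _
  rw [h2, Complex.norm_real, Real.norm_eq_abs, Real.norm_eq_abs,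
    abs_of_nonneg (Real.sqrt_nonneg _)] at hcauchy
  calc _ ≤ _ := hcauchy
    _ = _ := by field_simp

theorem exp_neg_one_le : Real.exp (-1) ≤ 0.4 := by
  have := Real.exp_neg_one_lt_d9
  norm_num at this ⊢
  linarith

/-- The degree lower bound for approximants of `exp (β x)` that stay bounded on `[0, δ]`. -/
theorem mul_sqrt_le_natDegree {β δ : ℝ} (hβ : 1 ≤ β) (hδ : 0 < δ) (hδ1 : δ ≤ 1) (q : ℝ[X])
    (happrox : ∀ x ∈ Set.Icc (-1 : ℝ) 0, |q.eval x - Real.exp (β * x)| ≤ 0.1)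
    (hbdd : ∀ x ∈ Set.Icc (0 : ℝ) δ, |q.eval x| ≤ 1) :
    1 / 20 * (β * √δ) ≤ (q.natDegree : ℝ) := by
  have hβ0 : 0 < β := by linarith
  have hinv : 1 / β ≤ 1 := by rw [div_le_one hβ0]; exact hβ
  have hinv0 : 0 < 1 / β := by positivity
  have hq0 : 0.9 ≤ q.eval 0 := by
    have := (abs_le.mp (happrox 0 (by norm_num))).1
    simp only [mul_zero, Real.exp_zero] at this
    linarith
  have hq1 : q.eval (-(1 / β)) ≤ 0.5 := by
    have := (abs_le.mp (happrox (-(1 / β)) ⟨by linarith, by linarith⟩)).2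
    have he : β * -(1 / β) = -1 := by field_simp
    rw [he] at this
    linarith [exp_neg_one_le]
  have hsqrt : √δ ≤ 1 := Real.sqrt_le_one.mpr hδ1
  rcases le_or_gt 2 β with hβ2 | hβ2
  · obtain ⟨x, ⟨hx1, hx2⟩, hx⟩ := exists_hasDerivAt_eq_slope (fun x => q.eval x)
      (fun x => q.derivative.eval x) (a := -(1 / β)) (b := 0) (by linarith)
      q.continuousOn (fun x _ => q.hasDerivAt x)
    have hder : 0.4 * β ≤ q.derivative.eval x := by
      rw [hx, le_div_iff₀ (by linarith)]
      have : 0.4 * β * (0 - -(1 / β)) = 0.4 := by field_simp; norm_num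
      linarith
    have hinv2 : 1 / β ≤ 1 / 2 := by gcongr
    set L : ℝ[X] := C ((1 + δ) / 2) * X + C ((δ - 1) / 2) with hL
    have hLe : ∀ s, L.eval s = (1 + δ) / 2 * s + (δ - 1) / 2 := by intro s; simp [hL]
    have hbound : ∀ s ∈ Set.Icc (-1 : ℝ) 1, |(q.comp L).eval s| ≤ 1.1 := by
      rintro s ⟨hs1, hs2⟩
      rw [eval_comp, hLe]
      set y := (1 + δ) / 2 * s + (δ - 1) / 2 with hy
      have hy1 : -1 ≤ y := by nlinarith
      have hy2 : y ≤ δ := by nlinarith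
      rcases le_total y 0 with h0 | h0
      · have h1 := abs_le.mp (happrox y ⟨hy1, h0⟩)
        have h2 : Real.exp (β * y) ≤ 1 := Real.exp_le_one_iff.mpr (by nlinarith)
        have h3 := Real.exp_pos (β * y)
        rw [abs_le]
        constructor <;> linarith [h1.1, h1.2]
      · exact (hbdd y ⟨h0, hy2⟩).trans (by norm_num)
    set s := (2 * x + 1 - δ) / (1 + δ) with hs
    have hLs : L.eval s = x := by
      rw [hLe, hs]
      field_simp
      ring
    have hsmem : s ∈ Set.Icc (-1 : ℝ) 1 := by
      constructor
      · rw [hs, le_div_iff₀ (by linarith)]; linarith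
      · rw [hs, div_le_iff₀ (by linarith)]; linarith
    have hB := abs_eval_derivative_mul_sqrt_le (q.comp L) hbound hsmem
    have hLd : L.derivative = C ((1 + δ) / 2) := by simp [hL]
    have hLdeg : L.natDegree ≤ 1 := by rw [hL]; exact natDegree_linear_le
    have hdeg : ((q.comp L).natDegree : ℝ) ≤ q.natDegree := by
      have : (q.comp L).natDegree ≤ q.natDegree :=
        natDegree_comp_le.trans (mul_le_of_le_one_right (Nat.zero_le _) hLdeg)
      exact_mod_cast this
    rw [derivative_comp, eval_mul, eval_comp, hLs, hLd, eval_C] at hB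
    -- As `β ≥ 2`, `x` lies in `(-1/2, 0)`: far from `-1`, and at least `δ` from the right endpoint.
    have hroot : √δ / (1 + δ) ≤ √(1 - s ^ 2) := by
      apply Real.le_sqrt_of_sq_le
      have h1 : 1 - s ^ 2 = 4 * ((1 + x) * (δ - x)) / (1 + δ) ^ 2 := by
        rw [hs]
        field_simp
        ring
      rw [h1, div_pow, Real.sq_sqrt hδ.le]
      gcongr
      nlinarith
    have hprod : 0.2 * β * √δ ≤ |(1 + δ) / 2 * q.derivative.eval x| * √(1 - s ^ 2) := by
      rw [abs_of_nonneg (by nlinarith)]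
      calc 0.2 * β * √δ = ((1 + δ) / 2 * (0.4 * β)) * (√δ / (1 + δ)) := by field_simp; norm_num
        _ ≤ _ := by
          have : 0 ≤ q.derivative.eval x := by linarith
          gcongr
    have he : Real.exp 1 ≤ 3 := by linarith [Real.exp_one_lt_d9]
    have hfin : Real.exp 1 * ((q.comp L).natDegree : ℝ) * 1.1 ≤ 3 * q.natDegree * 1.1 := by
      gcongr
    linarith
  -- For `β < 2` it suffices that `q` is not constant.
  · have hpos : 1 ≤ q.natDegree := by
      by_contra hcon
      rw [eq_C_of_natDegree_eq_zero (by omega : q.natDegree = 0)] at hq0 hq1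
      simp only [eval_C] at hq0 hq1
      linarith
    have hpos' : (1 : ℝ) ≤ q.natDegree := by exact_mod_cast hpos
    have : β * √δ ≤ 2 * 1 := by gcongr
    linarith

/-! ### Construction of the bounded approximant -/

/-- Integrating the translates of a polynomial against a continuous weight gives a polynomial
of at most the same degree. -/
theorem exists_polynomial_eval_eq_integral (Q : ℝ[X]) {g : ℝ → ℝ} (hg : Continuous g) (a b : ℝ) :
    ∃ p : ℝ[X], p.natDegree ≤ Q.natDegree ∧
      ∀ x, p.eval x = ∫ y in a..b, g y * Q.eval (x - y) := by
  refine ⟨∑ j ∈ Finset.range (Q.natDegree + 1),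
    C (∫ y in a..b, g y * (hasseDeriv j Q).eval (-y)) * X ^ j, ?_, fun x => ?_⟩
  · refine natDegree_sum_le_of_forall_le _ _ fun j hj => ?_
    exact (natDegree_C_mul_X_pow_le _ _).trans (Nat.lt_succ_iff.mp (Finset.mem_range.mp hj))
  · have hQ : ∀ y, g y * Q.eval (x - y) = ∑ j ∈ Finset.range (Q.natDegree + 1),
        g y * (hasseDeriv j Q).eval (-y) * x ^ j := by
      intro y
      rw [sub_eq_add_neg, ← taylor_eval, eval_eq_sum_range, natDegree_taylor, Finset.mul_sum]
      simp only [taylor_coeff, mul_assoc]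
    simp only [hQ]
    rw [intervalIntegral.integral_finsetSum fun j _ => Continuous.intervalIntegrable
      (by fun_prop) _ _, eval_finsetSum]
    refine Finset.sum_congr rfl fun j _ => ?_
    rw [intervalIntegral.integral_mul_const]
    simp

/-- Polynomials of degree `2 k` which are at most `1` in absolute value at distance between
`1 / β` and `3` from the origin, and exponentially large in `k / β` near the origin. -/
theorem exists_peak_polynomial {β : ℝ} (hβ : 1 ≤ β) (k : ℕ) :
    ∃ Q : ℝ[X], Q.natDegree ≤ 2 * k ∧
      (∀ u, 1 / β ≤ |u| → |u| ≤ 3 → |Q.eval u| ≤ 1) ∧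
      (∀ u, |u| ≤ 1 / β → 0 ≤ Q.eval u) ∧
      (∀ u, |u| ≤ 1 / (2 * β) → Real.exp (k / (3 * β)) / 2 ≤ Q.eval u) := by
  have hβ0 : 0 < β := by linarith
  -- `W` equals `1` at `|u| = 1/β`; the slope `2/9` keeps `W ≥ -1` up to `|u| = 3`.
  set W : ℝ[X] := C (1 + 2 / 9 * (1 / β) ^ 2) - C (2 / 9) * X ^ 2 with hW
  have hWe : ∀ u, W.eval u = 1 + 2 / 9 * ((1 / β) ^ 2 - |u| ^ 2) := by
    intro u
    rw [hW, sq_abs]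
    simp only [eval_sub, eval_C, eval_mul, eval_pow, eval_X]
    ring
  have hWd : W.natDegree ≤ 2 := by
    refine (natDegree_sub_le _ _).trans ?_
    rw [natDegree_C]
    simp
  have hinv0 : 0 < 1 / β := by positivity
  refine ⟨(Chebyshev.T ℝ k).comp W, ?_, fun u h1 h3 => ?_, fun u h1 => ?_, fun u h1 => ?_⟩
  · refine natDegree_comp_le.trans ?_
    rw [Chebyshev.natDegree_T, Int.natAbs_natCast, mul_comm]
    gcongr
  · rw [eval_comp]
    apply Chebyshev.abs_eval_T_real_le_one
    have : (1 / β) ^ 2 ≤ |u| ^ 2 := by gcongr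
    have : |u| ^ 2 ≤ 3 ^ 2 := by gcongr
    rw [hWe, abs_le]
    constructor <;> nlinarith
  · rw [eval_comp]
    have : |u| ^ 2 ≤ (1 / β) ^ 2 := by gcongr
    refine zero_le_one.trans (Chebyshev.one_le_eval_T_real _ ?_)
    rw [hWe]
    linarith
  · have hw : Real.cosh (1 / (3 * β)) ≤ W.eval u := by
      have h2 : |u| ^ 2 ≤ (1 / (2 * β)) ^ 2 := by gcongr
      have h3 : (1 / (2 * β)) ^ 2 = (1 / β) ^ 2 / 4 := by field_simp; norm_num
      have h4 : (1 / (3 * β)) ^ 2 / 2 = (1 / β) ^ 2 / 18 := by field_simp; norm_num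
      have h5 : (1 / β) ^ 2 ≤ 1 := pow_le_one₀ hinv0.le ((div_le_one hβ0).mpr hβ)
      refine (Real.cosh_le_exp_half_sq _).trans ?_
      rw [h4]
      have h6 := Real.abs_exp_sub_one_le (x := (1 / β) ^ 2 / 18)
        (by rw [abs_of_nonneg (by positivity)]; linarith)
      rw [abs_of_nonneg (by positivity : 0 ≤ (1 / β) ^ 2 / 18)] at h6
      have h7 := (abs_le.mp h6).2
      rw [hWe]
      linarith [sq_nonneg (1 / β)]
    have hw1 : 1 ≤ W.eval u := (Real.one_le_cosh _).trans hw
    rw [eval_comp, ← Real.cosh_arcosh hw1, Chebyshev.T_real_cosh]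
    have harc : 1 / (3 * β) ≤ Real.arcosh (W.eval u) := by
      have := hw
      rw [← Real.cosh_arcosh hw1, Real.cosh_le_cosh, abs_of_nonneg (by positivity),
        abs_of_nonneg (Real.arcosh_nonneg hw1)] at this
      exact this
    have hle : (k : ℝ) / (3 * β) ≤ k * Real.arcosh (W.eval u) := by
      rw [← mul_one_div]
      gcongr
    rw [Real.cosh_eq, Int.cast_natCast]
    have := Real.exp_le_exp.mpr hle
    have := Real.exp_pos (-(k * Real.arcosh (W.eval u)))
    linarith

/-- Smoothing `exp (β y)`, cut off at `1 / β`, by a peak polynomial. -/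
theorem exists_bounded_approx {β : ℝ} (hβ : 1 ≤ β) (k : ℕ)
    (hk : 3 * Real.exp 2 * β * 2 ≤ Real.exp (k / (3 * β))) :
    ∃ p : ℝ[X], p.natDegree ≤ 2 * k ∧
      (∀ x ∈ Set.Icc (-1 : ℝ) 1, |p.eval x| ≤ Real.exp 2 + 2) ∧
      (∀ x ∈ Set.Icc (-1 : ℝ) 0, |p.eval x - Real.exp (β * x)| ≤
        6 * Real.exp 2 * β / Real.exp (k / (3 * β))) := by
  obtain ⟨Q, hdeg, hout, hnn, hpeak⟩ := exists_peak_polynomial hβ k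
  have hβ0 : 0 < β := by linarith
  set E := Real.exp (k / (3 * β)) with hE
  have hE0 : 0 < E := Real.exp_pos _
  set a := 1 / β with ha
  have ha0 : 0 < a := by positivity
  have ha1 : a ≤ 1 := (div_le_one hβ0).mpr hβ
  have hβa : β * a = 1 := by rw [ha]; field_simp
  have hhalf : 1 / (2 * β) = a / 2 := by rw [ha]; field_simp
  rw [hhalf] at hpeak
  have hint : ∀ {f : ℝ → ℝ}, Continuous f → ∀ b c,
      IntervalIntegrable f MeasureTheory.volume b c := fun hf b c => hf.intervalIntegrable b c
  set e := Real.exp 1 with he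
  have he0 : 0 < e := Real.exp_pos _
  have he2 : Real.exp 2 = e * e := by rw [he, ← Real.exp_add]; norm_num
  have hc1 : Continuous fun u => Real.exp (-(β * u)) * Q.eval u := by fun_prop
  set J := ∫ u in (-a)..a, Real.exp (-(β * u)) * Q.eval u with hJ
  have hexp_ge : ∀ u, |u| ≤ a → e⁻¹ ≤ Real.exp (-(β * u)) := by
    intro u hu
    rw [he, ← Real.exp_neg, Real.exp_le_exp]
    have := (abs_le.mp hu).2
    nlinarith
  have hJE : E * a / (2 * e) ≤ J := by
    calc E * a / (2 * e) = ∫ u in (-(a / 2))..(a / 2), e⁻¹ * (E / 2) := by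
          rw [intervalIntegral.integral_const, smul_eq_mul]
          field_simp
          ring
      _ ≤ ∫ u in (-(a / 2))..(a / 2), Real.exp (-(β * u)) * Q.eval u := by
          refine intervalIntegral.integral_mono_on (by linarith) (hint continuous_const _ _)
            (hint hc1 _ _) fun u hu => ?_
          have hu' : |u| ≤ a / 2 := abs_le.mpr hu
          have := hexp_ge u (by linarith)
          have := hpeak u hu'
          gcongr
      _ ≤ J := by
          refine intervalIntegral.integral_mono_interval (by linarith) (by linarith)
            (by linarith) ?_ (hint hc1 _ _)
          refine (MeasureTheory.ae_restrict_iff' measurableSet_Ioc).mpr (.of_forall fun u hu => ?_)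
          exact mul_nonneg (Real.exp_pos _).le (hnn u (abs_le.mpr ⟨hu.1.le, hu.2⟩))
  have hJ0 : 0 < J := lt_of_lt_of_le (by positivity) hJE
  have hsmall : 3 * e / J ≤ 6 * Real.exp 2 * β / E := by
    rw [div_le_div_iff₀ hJ0 hE0, he2]
    calc 3 * e * E = 6 * (e * e) * β * (E * a / (2 * e)) := by
          rw [ha]; field_simp; norm_num
      _ ≤ _ := by gcongr
  have hsmall1 : 3 * e / J ≤ 1 := by
    refine hsmall.trans ((div_le_one hE0).mpr ?_)
    linarith
  -- For `x ∈ [-1, 0]` the window `[x - a, x + a]` lies in `[-2, a]`; for `x ∈ [-1, 1]`, `x - y`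
  -- stays in `[-3, 3]`.
  obtain ⟨R, hRdeg, hR⟩ := exists_polynomial_eval_eq_integral Q
    (g := fun y => Real.exp (β * y)) (by fun_prop) (-2) a
  have hle_e : ∀ y, y ≤ a → Real.exp (β * y) ≤ e := by
    intro y hy
    rw [he, Real.exp_le_exp]
    nlinarith
  have hc2 : ∀ x, Continuous fun y => Real.exp (β * y) * Q.eval (x - y) := by
    intro x
    fun_prop
  refine ⟨C J⁻¹ * R, (natDegree_C_mul_le _ _).trans (hRdeg.trans hdeg), ?_, ?_⟩
  · rintro x ⟨hx1, hx2⟩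
    have hQc : Continuous fun u => |Q.eval u| := by fun_prop
    have hQx : Continuous fun y => |Q.eval (x - y)| := by fun_prop
    have houter : ∀ b c : ℝ, b ≤ c → (∀ u ∈ Set.Icc b c, a ≤ |u| ∧ |u| ≤ 3) →
        ∫ u in b..c, |Q.eval u| ≤ c - b := by
      intro b c hbc h
      calc ∫ u in b..c, |Q.eval u| ≤ ∫ u in b..c, (1 : ℝ) :=
            intervalIntegral.integral_mono_on hbc (hint hQc _ _) (hint continuous_const _ _)
              fun u hu => hout u (h u hu).1 (h u hu).2
        _ = c - b := by simp
    have hmid : ∫ u in (-a)..a, |Q.eval u| ≤ e * J := by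
      rw [hJ, ← intervalIntegral.integral_const_mul]
      refine intervalIntegral.integral_mono_on (by linarith) (hint hQc _ _)
        (hint (by fun_prop) _ _) fun u hu => ?_
      have hu' : |u| ≤ a := abs_le.mpr hu
      have h0 := hnn u hu'
      rw [abs_of_nonneg h0, ← mul_assoc]
      have h1 := mul_le_mul_of_nonneg_left (hexp_ge u hu') he0.le
      rw [mul_inv_cancel₀ he0.ne'] at h1
      nlinarith
    have h3 : ∫ u in (-3 : ℝ)..3, |Q.eval u| ≤ e * J + 6 := by
      rw [← intervalIntegral.integral_add_adjacent_intervals (hint hQc (-3) (-a)) (hint hQc (-a) 3),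
        ← intervalIntegral.integral_add_adjacent_intervals (hint hQc (-a) a) (hint hQc a 3)]
      have h4 := houter (-3) (-a) (by linarith) fun u hu => by
        rw [abs_of_nonpos (by linarith [hu.2])]
        exact ⟨by linarith [hu.2], by linarith [hu.1]⟩
      have h5 := houter a 3 (by linarith) fun u hu => by
        rw [abs_of_nonneg (by linarith [hu.1])]
        exact ⟨hu.1, hu.2⟩
      linarith
    have hRx : |R.eval x| ≤ e * (e * J + 6) := by
      rw [hR]
      calc |∫ y in (-2)..a, Real.exp (β * y) * Q.eval (x - y)|
          ≤ ∫ y in (-2)..a, |Real.exp (β * y) * Q.eval (x - y)| :=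
            intervalIntegral.abs_integral_le_integral_abs (by linarith)
        _ ≤ ∫ y in (-2)..a, e * |Q.eval (x - y)| := by
            refine intervalIntegral.integral_mono_on (by linarith) (hint (hc2 x).abs _ _)
              (hint (by fun_prop) _ _) fun y hy => ?_
            rw [abs_mul, abs_of_pos (Real.exp_pos _)]
            have := hle_e y hy.2
            gcongr
        _ = e * ∫ u in (x - a)..(x - -2), |Q.eval u| := by
            rw [intervalIntegral.integral_const_mul,
              intervalIntegral.integral_comp_sub_left (fun u => |Q.eval u|)]
        _ ≤ e * ∫ u in (-3 : ℝ)..3, |Q.eval u| := by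
            gcongr
            exact intervalIntegral.integral_mono_interval (by linarith) (by linarith)
              (by linarith) (.of_forall fun u => abs_nonneg _) (hint hQc _ _)
        _ ≤ _ := by gcongr
    rw [eval_mul, eval_C, abs_mul, abs_of_pos (inv_pos.mpr hJ0), inv_mul_le_iff₀ hJ0, he2]
    have : 3 * e ≤ J := (div_le_one hJ0).mp hsmall1
    nlinarith
  · rintro x ⟨hx1, hx2⟩
    have hmid : ∫ y in (x - a)..(x + a), Real.exp (β * y) * Q.eval (x - y) =
        Real.exp (β * x) * J := by
      have h1 := intervalIntegral.integral_comp_sub_left (a := x - a) (b := x + a)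
        (fun u => Real.exp (β * (x - u)) * Q.eval u) x
      simp only [sub_sub_cancel, sub_add_cancel_left] at h1
      rw [h1, hJ, ← intervalIntegral.integral_const_mul]
      congr 1
      ext u
      rw [← mul_assoc, ← Real.exp_add]
      ring_nf
    have houter : ∀ b c : ℝ, -2 ≤ b → b ≤ c → c ≤ a →
        (∀ y ∈ Set.Icc b c, a ≤ |x - y|) →
        |∫ y in b..c, Real.exp (β * y) * Q.eval (x - y)| ≤ e * (c - b) := by
      intro b c hb hbc hca h
      have h1 := intervalIntegral.norm_integral_le_of_norm_le_const (a := b) (b := c) (C := e)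
        (f := fun y => Real.exp (β * y) * Q.eval (x - y)) fun y hy => by
          rw [Set.uIoc_of_le hbc] at hy
          rw [norm_mul, Real.norm_eq_abs, Real.norm_eq_abs, abs_of_pos (Real.exp_pos _)]
          have h2 := hle_e y (hy.2.trans hca)
          have h3 := hout (x - y) (h y ⟨hy.1.le, hy.2⟩)
            (abs_le.mpr ⟨by linarith [hy.2], by linarith [hy.1]⟩)
          calc _ ≤ e * 1 := by gcongr
            _ = e := mul_one e
      rwa [abs_of_nonneg (by linarith : 0 ≤ c - b)] at h1
    have h4 := houter (-2) (x - a) le_rfl (by linarith) (by linarith) fun y hy => by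
      rw [abs_of_nonneg (by linarith [hy.2])]
      linarith [hy.2]
    have h5 := houter (x + a) a (by linarith) (by linarith) le_rfl fun y hy => by
      rw [abs_of_nonpos (by linarith [hy.1])]
      linarith [hy.1]
    have hdiff : |R.eval x - Real.exp (β * x) * J| ≤ 3 * e := by
      rw [hR, ← hmid, ← intervalIntegral.integral_add_adjacent_intervals
          (hint (hc2 x) (-2) (x - a)) (hint (hc2 x) (x - a) a),
        ← intervalIntegral.integral_add_adjacent_intervals
          (hint (hc2 x) (x - a) (x + a)) (hint (hc2 x) (x + a) a)]
      rw [abs_le] at h4 h5 ⊢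
      constructor <;> nlinarith [h4.1, h4.2, h5.1, h5.2]
    refine le_trans ?_ hsmall
    have heq : (C J⁻¹ * R).eval x - Real.exp (β * x) =
        (R.eval x - Real.exp (β * x) * J) / J := by
      rw [eval_mul, eval_C]
      field_simp
    rw [heq, abs_div, abs_of_pos hJ0]
    gcongr

theorem exp_two_le : Real.exp 2 ≤ 8 := by
  have h := Real.exp_one_lt_d9
  have h0 := Real.exp_pos 1
  have : Real.exp 2 = Real.exp 1 * Real.exp 1 := by rw [← Real.exp_add]; norm_num
  norm_num at h
  nlinarith

/-- Bounded approximation of `exp (β x)` in degree `O(β log (β / ε))`. -/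
theorem exists_approx_exp_natDegree_le {β ε : ℝ} (hβ : 1 ≤ β) (hε : 0 < ε) (hε1 : ε < 1) :
    ∃ p : ℝ[X], (p.natDegree : ℝ) ≤ 64 * (β * Real.log (β / ε)) ∧
      (∀ x ∈ Set.Icc (-1 : ℝ) 1, |p.eval x| ≤ 10) ∧
      (∀ x ∈ Set.Icc (-1 : ℝ) 0, |p.eval x - Real.exp (β * x)| ≤ ε) := by
  have hβ0 : 0 < β := by linarith
  rcases le_or_gt (1 / 2) ε with h | h
  -- On `[-1, 0]` the exponential takes values in `(0, 1]`.
  · refine ⟨C (1 / 2), ?_, fun x _ => ?_, fun x hx => ?_⟩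
    · have : 0 ≤ Real.log (β / ε) := Real.log_nonneg (by rw [le_div_iff₀ hε]; linarith)
      rw [natDegree_C]
      push_cast
      positivity
    · rw [eval_C, abs_of_pos] <;> norm_num
    · have h1 : Real.exp (β * x) ≤ 1 := Real.exp_le_one_iff.mpr (by nlinarith [hx.2])
      have h2 := Real.exp_pos (β * x)
      rw [eval_C, abs_le]
      constructor <;> linarith
  · have hx2 : 2 ≤ β / ε := by rw [le_div_iff₀ hε]; linarith
    have hpos : 0 < β / ε := by positivity
    set Λ := Real.log (β / ε) with hΛ
    have hlog : 0.69 ≤ Λ := by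
      have h1 := Real.log_two_gt_d9
      have h2 := Real.log_le_log two_pos hx2
      norm_num at h1 ⊢
      linarith
    -- This makes `k / (3 β) ≥ 7 Λ`: one `Λ` yields `β/ε`, and six yield `2 ^ 6 ≥ 48 = 6 * 8`,
    -- absorbing `6 e²`.
    set k := ⌈21 * (β * Λ)⌉₊ with hk
    have hk1 : 21 * (β * Λ) ≤ k := Nat.le_ceil _
    have hk2 : (k : ℝ) < 21 * (β * Λ) + 1 := Nat.ceil_lt_add_one (by positivity)
    have hexp : 48 * β / ε ≤ Real.exp (k / (3 * β)) := by
      have h1 : Λ + 6 * Λ ≤ k / (3 * β) := by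
        rw [le_div_iff₀ (by positivity)]
        linarith
      have h2 : 48 ≤ Real.exp (6 * Λ) := by
        have h3 : Real.exp (6 * Λ) = (β / ε) ^ 6 := by
          rw [hΛ, ← Real.exp_log (pow_pos hpos 6), Real.log_pow]
          norm_num
        rw [h3]
        calc (48 : ℝ) ≤ 2 ^ 6 := by norm_num
          _ ≤ _ := by gcongr
      calc 48 * β / ε = β / ε * 48 := by ring
        _ ≤ Real.exp Λ * Real.exp (6 * Λ) := by
            rw [hΛ, Real.exp_log hpos]
            gcongr
        _ ≤ _ := by
            rw [← Real.exp_add]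
            exact Real.exp_le_exp.mpr h1
    have h8 := exp_two_le
    have hβe : 48 * β ≤ 48 * β / ε := by
      rw [le_div_iff₀ hε]
      nlinarith
    obtain ⟨p, hdeg, hb, ha⟩ := exists_bounded_approx hβ k (by nlinarith)
    refine ⟨p, ?_, fun x hx => (hb x hx).trans (by linarith), fun x hx => (ha x hx).trans ?_⟩
    · have h1 : (p.natDegree : ℝ) ≤ 2 * k := by exact_mod_cast hdeg
      have h2 : 0.69 ≤ β * Λ := by nlinarith
      linarith
    · rw [div_le_iff₀ (Real.exp_pos _)]
      calc 6 * Real.exp 2 * β ≤ 6 * 8 * β := by gcongr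
        _ = ε * (48 * β / ε) := by field_simp; norm_num
        _ ≤ _ := by gcongr

theorem corollary3p5 :
    -- the bounded approximation, with universal constants `C` and `K`
    (∃ C K : ℝ, 0 < C ∧ 0 < K ∧
      ∀ β ε : ℝ, 1 ≤ β → 0 < ε → ε < 1 →
        ∃ p : ℝ[X],
          (p.natDegree : ℝ) ≤ C * (β * Real.log (β / ε)) ∧
          intervalNorm (fun x => p.eval x) (-1) 1 ≤ K ∧
          intervalNorm (fun x => p.eval x - Real.exp (β * x)) (-1) 0 ≤ ε) ∧
    -- the degree lower bound, with a universal constant `c`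
    (∃ c : ℝ, 0 < c ∧
      ∀ β δ : ℝ, 1 ≤ β → 0 < δ → δ ≤ 1 →
        ∀ q : ℝ[X],
          (∀ x ∈ Set.Icc (-1 : ℝ) 0, |q.eval x - Real.exp (β * x)| ≤ 0.1) →
          (∀ x ∈ Set.Icc (0 : ℝ) δ, |q.eval x| ≤ 1) →
          c * (β * Real.sqrt δ) ≤ (q.natDegree : ℝ)) := by
  refine ⟨⟨64, 10, by norm_num, by norm_num, fun β ε hβ hε hε1 => ?_⟩,
    1 / 20, by norm_num, fun β δ hβ hδ hδ1 q h1 h2 => mul_sqrt_le_natDegree hβ hδ hδ1 q h1 h2⟩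
  obtain ⟨p, hdeg, hb, ha⟩ := exists_approx_exp_natDegree_le hβ hε hε1
  exact ⟨p, hdeg, (intervalNorm_le_iff (by norm_num) (by fun_prop)).mpr hb,
    (intervalNorm_le_iff (by norm_num) (by fun_prop)).mpr ha⟩
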